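/- Let $\Omega\subset\mathbb{C}$ be a simply connected open set with $0\notin\Omega$ and $0\in\overline{\Omega}$, star-shaped around $0$ in the sense that $ta\in\Omega$ for all $a\in\Omega$ and $t\in(0,1]$. Let $p,q$ be holomorphic on $\Omega$ with $p$ nowhere zero, put $k_0(a,a')=-q(a')/p(a)$, and let $k_\star$ be holomorphic on $\Omega\times\Omega$. For a kernel $w$ write $[\mathcal{V}_w\varphi](a)=\int_0^a w(a,a')\,\varphi(a')\,da'$, the integral being taken along the straight path from $0$ to $a\in\Omega$, and put $\mathcal{V}=\mathcal{V}_{k_0}+\mathcal{V}_{k_\star}$. Suppose that $\tau>0$, $\gamma>0$ and $\lambda_\Delta\in\mathbb{R}$ are constants such that: - (sing) $k_0(a,a)-\tau/a$ is bounded on a neighborhood of $0$ in $\Omega$, and for each $\sigma>\tau$ there is a neighborhood of $(0,0)$ in $\Omega\times\Omega$ on which $|k_0(a,a')|<\sigma/|a|$; - (diag$_0$) there is a constant $C$ with $|k_0(a,a')|\le \dfrac{C}{|a|}\,e^{\lambda_\Delta|a-a'|}$ for all $a,a'\in\Omega$; - (diag$_\star$) there is a constant $C$ with $|k_\star(a,a')|\le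 C\,\dfrac{|a-a'|^\gamma}{|a|}\,e^{\lambda_\Delta|a-a'|}$ for all $a,a'\in\Omega$. For $\sigma\in\mathbb{R}$ let $\mathcal{E}^{\sigma}(\Omega)$ be the space of holomorphic functions $f$ on $\Omega$ for which there are real constants $\Lambda$ and $M$ with $|f(a)|\le M|a|^{\sigma}e^{\Lambda|a|}$ for all $a\in\Omega$. Let $\rho>\tau$ and $g\in\mathcal{E}^{\rho-1}(\Omega)$. Then for every $\varphi\in\mathcal{E}^{\rho-1}(\Omega)$ and $a\in\Omega$ the integrals defining $[\mathcal{V}_{k_0}\varphi](a)$ and $[\mathcal{V}_{k_\star}\varphi](a)$ converge absolutely, and the inhomogeneous equation \[ f=\mathcal{V}f+g \quad\text{on }\Omega \] has a unique solution $f$ in $\mathcal{E}^{\rho-1}(\Omega)$. -/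

import Mathlib

open Topology Filter

noncomputable section

namespace HolVolterra

/-- `Ω` is star-shaped around `0`, where `0` itself is omitted from the straight paths:
for every `a ∈ Ω` the half-open segment `(0, a]` lies in `Ω`. -/
def IsStarAroundZero (Ω : Set ℂ) : Prop :=
  ∀ a ∈ Ω, ∀ t : ℝ, 0 < t → t ≤ 1 → (t : ℂ) * a ∈ Ω

/-- The integrand of the Volterra integral `∫_{0}^{a} w(a, a') φ(a') da'`
pulled back to `t ∈ (0, 1]` along the straight path `a' = t a`. -/
def volterraIntegrand (w : ℂ → ℂ → ℂ) (φ : ℂ → ℂ) (a : ℂ) (t : ℝ) : ℂ :=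
  w a ((t : ℂ) * a) * φ ((t : ℂ) * a) * a

/-- The Volterra integral of `φ` at `a` converges absolutely. -/
def VolterraConverges (w : ℂ → ℂ → ℂ) (φ : ℂ → ℂ) (a : ℂ) : Prop :=
  IntervalIntegrable (volterraIntegrand w φ a) MeasureTheory.volume 0 1

/-- The Volterra operator with kernel `w`:
`[W φ](a) = ∫_{0}^{a} w(a, a') φ(a') da'`, along the straight path from `0` to `a`. -/
def volterra (w : ℂ → ℂ → ℂ) (φ : ℂ → ℂ) (a : ℂ) : ℂ :=
  ∫ t in (0 : ℝ)..1, volterraIntegrand w φ a t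

/-- The kernel `w` is a holomorphic function on `Ω × Ω`. -/
def IsHolKernel (Ω : Set ℂ) (w : ℂ → ℂ → ℂ) : Prop :=
  DifferentiableOn ℂ (fun z : ℂ × ℂ => w z.1 z.2) (Ω ×ˢ Ω)

/-- The separable kernel `(a, a') ↦ - q(a') / p(a)`. -/
def sepKernel (p q : ℂ → ℂ) (a a' : ℂ) : ℂ := -(q a' / p a)

/-- Regular singularity at `0` with constant `τ`. -/
def CondSing (Ω : Set ℂ) (k : ℂ → ℂ → ℂ) (τ : ℝ) : Prop :=
  0 < τ ∧
  (∃ C : ℝ, ∀ᶠ a in 𝓝[Ω] (0 : ℂ), ‖k a a - (τ : ℂ) / a‖ ≤ C) ∧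
  (∀ σ : ℝ, τ < σ →
    ∀ᶠ z : ℂ × ℂ in 𝓝[Ω ×ˢ Ω] ((0 : ℂ), (0 : ℂ)), ‖k z.1 z.2‖ < σ / ‖z.1‖)

/-- `|k(a, a')| ≲ |a|⁻¹ e^{l |a - a'|}` over all `a, a' ∈ Ω`. -/
def CondDiag (Ω : Set ℂ) (k : ℂ → ℂ → ℂ) (l : ℝ) : Prop :=
  ∃ C : ℝ, ∀ a ∈ Ω, ∀ a' ∈ Ω, ‖k a a'‖ ≤ C * (1 / ‖a‖ * Real.exp (l * ‖a - a'‖))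

/-- `γ > 0` and `|k(a, a')| ≲ |a - a'|^γ |a|⁻¹ e^{l |a - a'|}` over all `a, a' ∈ Ω`. -/
def CondDiagStar (Ω : Set ℂ) (k : ℂ → ℂ → ℂ) (γ l : ℝ) : Prop :=
  0 < γ ∧ ∃ C : ℝ, ∀ a ∈ Ω, ∀ a' ∈ Ω,
    ‖k a a'‖ ≤ C * (‖a - a'‖ ^ γ / ‖a‖ * Real.exp (l * ‖a - a'‖))

/-- The space of holomorphic `f` on `Ω` with `|f| ≲ |ζ|^σ e^{L |ζ|}` over `Ω`.
Values outside `Ω` are irrelevant. -/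
def singExp (σ L : ℝ) (Ω : Set ℂ) : Set (ℂ → ℂ) :=
  {f | DifferentiableOn ℂ f Ω ∧
    ∃ M : ℝ, ∀ a ∈ Ω, ‖f a‖ ≤ M * (‖a‖ ^ σ * Real.exp (L * ‖a‖))}

/-- The union over all real `L` of the spaces `singExp σ L Ω`. -/
def singExpAlg (σ : ℝ) (Ω : Set ℂ) : Set (ℂ → ℂ) := ⋃ L : ℝ, singExp σ L Ω

end HolVolterra

end

/-! The operator is a contraction for the norm with weight `|a|^(ρ-1) e^{L|a|}` once `L` is large.
On `a' = ta` the ratio of the weights at `a'` and `a` is `t^(ρ-1) e^{-L(1-t)|a|}`, and `∫₀¹ t^(ρ-1)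
dt = 1/ρ`. Choose `τ < s < u < ρ`.

For `|a| < ε`, (sing) gives `|k₀| |a| ≤ s`, so `k₀` contributes at most `s/ρ`. For `|a| ≥ ε`,
(diag₀) bounds the integrand by a multiple of `t^(ρ-1) e^{-(L-λ)(1-t)ε}`, whose integral vanishes as
`L → ∞`. The extra factor `|a-a'|^γ` makes the contribution of `k⋆` at most `(u-s)/ρ` for large `L`.
The total is `c = u/ρ < 1` (`eventually_volterraBoundedBy`).

The Neumann series then gives existence (`exists_solution`). For uniqueness, the difference of two
solutions is fixed by the operator, hence zero (`eq_zero_of_le_const_mul`); a single `L` can be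
taken large enough for both. -/

open MeasureTheory Set

/-- A parameter integral of functions holomorphic in the parameter, dominated locally in the
parameter by integrable functions, is holomorphic. -/
theorem differentiableOn_integral_of_locally_dominated {α : Type*} [MeasurableSpace α]
    {μ : Measure α} {U : Set ℂ} (hU : IsOpen U) {F : ℂ → α → ℂ}
    (hmeas : ∀ z ∈ U, AEStronglyMeasurable (F z) μ)
    (hdiff : ∀ᵐ t ∂μ, DifferentiableOn ℂ (fun z => F z t) U)
    (hbound : ∀ z ∈ U, ∃ s ∈ 𝓝 z, ∃ b : α → ℝ, Integrable b μ ∧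
      ∀ᵐ t ∂μ, ∀ w ∈ s, ‖F w t‖ ≤ b t) :
    DifferentiableOn ℂ (fun z => ∫ t, F z t ∂μ) U := by
  intro z hz
  obtain ⟨s, hs, b, hb, hFb⟩ := hbound z hz
  obtain ⟨R, hR, hRs⟩ := Metric.mem_nhds_iff.1 (inter_mem hs (hU.mem_nhds hz))
  have hderiv : ∀ᵐ t ∂μ, ∀ x ∈ Metric.ball z (R / 2),
      HasDerivAt (fun w => F w t) (deriv (fun w => F w t) x) x := by
    filter_upwards [hdiff] with t ht x hx
    have hxR : x ∈ Metric.ball z R := Metric.ball_subset_ball (by linarith) hx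
    exact (ht.differentiableAt (hU.mem_nhds (hRs hxR).2)).hasDerivAt
  have hderiv_le : ∀ᵐ t ∂μ, ∀ x ∈ Metric.ball z (R / 2),
      ‖deriv (fun w => F w t) x‖ ≤ b t / (R / 4) := by
    filter_upwards [hdiff, hFb] with t ht hbt x hx
    have hsub : Metric.closedBall x (R / 4) ⊆ Metric.ball z R := by
      intro y hy
      rw [Metric.mem_closedBall] at hy
      rw [Metric.mem_ball] at hx ⊢
      linarith [dist_triangle y x z]
    -- Cauchy's estimate on a circle of radius `R/4`, which stays inside the ball where `b`
    -- dominates.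
    refine Complex.norm_deriv_le_of_forall_mem_sphere_norm_le (by positivity) ?_ fun y hy => ?_
    · apply DifferentiableOn.diffContOnCl
      refine ht.mono fun y hy => (hRs (hsub ?_)).2
      exact Metric.closure_ball_subset_closedBall hy
    · exact hbt y (hRs (hsub (Metric.sphere_subset_closedBall hy))).1
  have hmeas' : AEStronglyMeasurable (fun t => deriv (fun w => F w t) z) μ := by
    obtain ⟨x, hx⟩ := exists_seq_tendsto (𝓝[≠] z)
    obtain ⟨N, hN⟩ := eventually_atTop.1
      ((hx.mono_right nhdsWithin_le_nhds).eventually (hU.mem_nhds hz))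
    -- The derivative is a limit of difference quotients; the shift by `N` keeps every sample point
    -- in `U`.
    refine aestronglyMeasurable_of_tendsto_ae atTop
      (f := fun n t => slope (fun w => F w t) z (x (n + N))) (fun n => ?_) ?_
    · simp only [slope_def_module]
      exact ((hmeas _ (hN _ (Nat.le_add_left _ _))).sub (hmeas _ hz)).const_smul
        ((x (n + N) - z)⁻¹)
    · filter_upwards [hderiv] with t ht
      exact (hasDerivAt_iff_tendsto_slope.1 (ht z (Metric.mem_ball_self (by positivity)))).comp
        (hx.comp (tendsto_add_atTop_nat N))
  have hint : Integrable (F z) μ :=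
    hb.mono' (hmeas z hz) (hFb.mono fun t ht => ht z (mem_of_mem_nhds hs))
  exact (hasDerivAt_integral_of_dominated_loc_of_deriv_le
    (Metric.ball_mem_nhds z (by positivity : 0 < R / 2))
    ((hU.eventually_mem hz).mono hmeas) hint hmeas' hderiv_le
    (hb.div_const _) hderiv).2.differentiableAt.differentiableWithinAt

/-! ### Convergence and holomorphy of Volterra integrals -/

namespace HolVolterra

/-- `φ` is bounded by `M` in the norm with weight `|a|^σ e^{L|a|}` on `Ω`. -/
def WeightedBound (Ω : Set ℂ) (σ L M : ℝ) (φ : ℂ → ℂ) : Prop :=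
  ∀ a ∈ Ω, ‖φ a‖ ≤ M * (‖a‖ ^ σ * Real.exp (L * ‖a‖))

/-- Along the segments `(0, a]` the kernel is bounded by a continuous function of `|a|`. -/
def RadiallyBounded (Ω : Set ℂ) (K : ℂ → ℂ → ℂ) : Prop :=
  ∃ D : ℝ → ℝ, ContinuousOn D (Ioi 0) ∧
    ∀ a ∈ Ω, ∀ t : ℝ, 0 < t → t ≤ 1 → ‖K a ((t : ℂ) * a)‖ ≤ D ‖a‖

variable {Ω : Set ℂ} {K : ℂ → ℂ → ℂ} {φ : ℂ → ℂ} {σ L M : ℝ}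

theorem norm_pos_of_mem (hΩ0 : (0 : ℂ) ∉ Ω) {a : ℂ} (ha : a ∈ Ω) : 0 < ‖a‖ :=
  norm_pos_iff.2 fun h => hΩ0 (h ▸ ha)

/-- Factors the weight at `a` out of the weight at `ta`; the decay `e^{-L(1-t)|a|}` left over is the
source of all smallness for large `L`. -/
theorem norm_volterraIntegrand_le (hΩstar : IsStarAroundZero Ω)
    (hφ : WeightedBound Ω σ L M φ) {a : ℂ} (ha : a ∈ Ω) {t : ℝ} (ht0 : 0 < t) (ht1 : t ≤ 1) :
    ‖volterraIntegrand K φ a t‖ ≤ M * (‖a‖ ^ σ * Real.exp (L * ‖a‖)) *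
      (t ^ σ * (‖K a ((t : ℂ) * a)‖ * ‖a‖ * Real.exp (-(L * ((1 - t) * ‖a‖))))) := by
  have h := hφ _ (hΩstar a ha t ht0 ht1)
  have hn : ‖(t : ℂ) * a‖ = t * ‖a‖ := by simp [abs_of_pos ht0]
  rw [hn, Real.mul_rpow ht0.le (norm_nonneg a)] at h
  have he : Real.exp (L * (t * ‖a‖)) =
      Real.exp (L * ‖a‖) * Real.exp (-(L * ((1 - t) * ‖a‖))) := by
    rw [← Real.exp_add]; ring_nf
  rw [he] at h
  calc ‖volterraIntegrand K φ a t‖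
      = ‖K a ((t : ℂ) * a)‖ * ‖a‖ * ‖φ ((t : ℂ) * a)‖ := by
        simp only [volterraIntegrand, norm_mul]; ring
    _ ≤ ‖K a ((t : ℂ) * a)‖ * ‖a‖ * _ := mul_le_mul_of_nonneg_left h (by positivity)
    _ = _ := by ring

/-- Continuity of `E` makes the bound locally uniform in `a`, and linearity in `M` makes it summable
along the Neumann series. -/
theorem RadiallyBounded.exists_integrand_bound (hK : RadiallyBounded Ω K)
    (hΩ0 : (0 : ℂ) ∉ Ω) (hΩstar : IsStarAroundZero Ω) (σ L : ℝ) :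
    ∃ E : ℝ → ℝ, ContinuousOn E (Ioi 0) ∧ ∀ φ M, 0 ≤ M → WeightedBound Ω σ L M φ →
      ∀ a ∈ Ω, ∀ t : ℝ, 0 < t → t ≤ 1 →
        ‖volterraIntegrand K φ a t‖ ≤ M * (E ‖a‖ * t ^ σ) := by
  obtain ⟨D, hD, hKD⟩ := hK
  refine ⟨fun r => r ^ σ * Real.exp (L * r) * (D r * r * Real.exp (|L| * r)), ?_, ?_⟩
  · have h1 : ContinuousOn (fun r : ℝ => r ^ σ) (Ioi 0) := fun r hr =>
      (Real.continuousAt_rpow_const r σ (Or.inl (ne_of_gt hr))).continuousWithinAt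
    exact (h1.mul (by fun_prop)).mul ((hD.mul continuousOn_id).mul (by fun_prop))
  · intro φ M hM hφ a ha t ht0 ht1
    refine (norm_volterraIntegrand_le hΩstar hφ ha ht0 ht1).trans ?_
    have hr := norm_pos_of_mem hΩ0 ha
    have he : Real.exp (-(L * ((1 - t) * ‖a‖))) ≤ Real.exp (|L| * ‖a‖) := by
      apply Real.exp_le_exp.2
      have h1 : -L ≤ |L| := neg_le_abs L
      have h2 : (1 - t) * ‖a‖ ≤ ‖a‖ := by nlinarith
      have h3 : 0 ≤ (1 - t) * ‖a‖ := mul_nonneg (by linarith) hr.le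
      nlinarith [abs_nonneg L]
    have hD0 : 0 ≤ D ‖a‖ := (norm_nonneg _).trans (hKD a ha t ht0 ht1)
    calc _ ≤ M * (‖a‖ ^ σ * Real.exp (L * ‖a‖)) *
          (t ^ σ * (D ‖a‖ * ‖a‖ * Real.exp (|L| * ‖a‖))) := by
          gcongr; exact hKD a ha t ht0 ht1
      _ = _ := by ring

theorem differentiableOn_volterraIntegrand (hΩstar : IsStarAroundZero Ω)
    (hK : IsHolKernel Ω K) (hφ : DifferentiableOn ℂ φ Ω) {t : ℝ} (ht0 : 0 < t) (ht1 : t ≤ 1) :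
    DifferentiableOn ℂ (fun a => volterraIntegrand K φ a t) Ω := by
  have hm : MapsTo (fun a : ℂ => (t : ℂ) * a) Ω Ω := fun a ha => hΩstar a ha t ht0 ht1
  have h1 : DifferentiableOn ℂ (fun a => K a ((t : ℂ) * a)) Ω :=
    hK.comp (f := fun a : ℂ => (a, (t : ℂ) * a))
      (by fun_prop) fun a ha => ⟨ha, hm ha⟩
  exact (h1.mul (hφ.comp (by fun_prop) hm)).mul differentiableOn_id

theorem aestronglyMeasurable_volterraIntegrand (hΩstar : IsStarAroundZero Ω)
    (hK : IsHolKernel Ω K) (hφ : DifferentiableOn ℂ φ Ω) {a : ℂ} (ha : a ∈ Ω) :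
    AEStronglyMeasurable (volterraIntegrand K φ a) (volume.restrict (Ioc 0 1)) := by
  have hm : MapsTo (fun t : ℝ => (t : ℂ) * a) (Ioc 0 1) Ω := fun t ht => hΩstar a ha t ht.1 ht.2
  have h1 : ContinuousOn (fun t : ℝ => K a ((t : ℂ) * a)) (Ioc 0 1) :=
    hK.continuousOn.comp (f := fun t : ℝ => (a, (t : ℂ) * a))
      (by fun_prop) fun t ht => ⟨ha, hm ht⟩
  have h2 : ContinuousOn (volterraIntegrand K φ a) (Ioc 0 1) :=
    (h1.mul (hφ.continuousOn.comp (by fun_prop) hm)).mul continuousOn_const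
  exact h2.aestronglyMeasurable measurableSet_Ioc

theorem integrable_rpow_unit (hσ : -1 < σ) :
    Integrable (fun t : ℝ => t ^ σ) (volume.restrict (Ioc 0 1)) :=
  (intervalIntegrable_iff_integrableOn_Ioc_of_le zero_le_one).1
    (intervalIntegral.intervalIntegrable_rpow' hσ)

theorem volterraConverges_of_bound (hΩ0 : (0 : ℂ) ∉ Ω) (hΩstar : IsStarAroundZero Ω)
    (hK : IsHolKernel Ω K) (hKb : RadiallyBounded Ω K) (hσ : -1 < σ)
    (hφ : DifferentiableOn ℂ φ Ω) (hM : 0 ≤ M) (hφb : WeightedBound Ω σ L M φ)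
    {a : ℂ} (ha : a ∈ Ω) : VolterraConverges K φ a := by
  obtain ⟨E, -, hE⟩ := hKb.exists_integrand_bound hΩ0 hΩstar σ L
  refine (intervalIntegrable_iff_integrableOn_Ioc_of_le zero_le_one).2 ?_
  refine Integrable.mono' (((integrable_rpow_unit hσ).const_mul (E ‖a‖)).const_mul M)
    (aestronglyMeasurable_volterraIntegrand hΩstar hK hφ ha) ?_
  filter_upwards [ae_restrict_mem measurableSet_Ioc] with t ht
  exact hE φ M hM hφb a ha t ht.1 ht.2

theorem differentiableOn_volterra (hΩo : IsOpen Ω) (hΩ0 : (0 : ℂ) ∉ Ω)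
    (hΩstar : IsStarAroundZero Ω)
    (hK : IsHolKernel Ω K) (hKb : RadiallyBounded Ω K) (hσ : -1 < σ)
    (hφ : DifferentiableOn ℂ φ Ω) (hM : 0 ≤ M) (hφb : WeightedBound Ω σ L M φ) :
    DifferentiableOn ℂ (volterra K φ) Ω := by
  obtain ⟨E, hEc, hE⟩ := hKb.exists_integrand_bound hΩ0 hΩstar σ L
  have heq : volterra K φ = fun a => ∫ t in Ioc (0 : ℝ) 1, volterraIntegrand K φ a t := by
    funext a; exact intervalIntegral.integral_of_le zero_le_one
  rw [heq]
  refine differentiableOn_integral_of_locally_dominated hΩo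
    (fun a ha => aestronglyMeasurable_volterraIntegrand hΩstar hK hφ ha) ?_ fun a ha => ?_
  · filter_upwards [ae_restrict_mem measurableSet_Ioc] with t ht
    exact differentiableOn_volterraIntegrand hΩstar hK hφ ht.1 ht.2
  · have hca : ContinuousAt (fun z : ℂ => E ‖z‖) a :=
      ContinuousAt.comp (f := fun z : ℂ => ‖z‖)
        (hEc.continuousAt (Ioi_mem_nhds (norm_pos_of_mem hΩ0 ha))) continuous_norm.continuousAt
    refine ⟨{z | E ‖z‖ < E ‖a‖ + 1} ∩ Ω,
      inter_mem (hca.eventually_lt_const (lt_add_one _)) (hΩo.mem_nhds ha), _,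
      ((integrable_rpow_unit hσ).const_mul (E ‖a‖ + 1)).const_mul M, ?_⟩
    filter_upwards [ae_restrict_mem measurableSet_Ioc] with t ht z hz
    refine (hE φ M hM hφb z hz.2 t ht.1 ht.2).trans ?_
    have := ht.1
    gcongr
    exact le_of_lt hz.1

end HolVolterra

/-! ### Weighted estimates, uniqueness and the Neumann series -/

namespace HolVolterra

variable {Ω : Set ℂ} {K : ℂ → ℂ → ℂ} {φ : ℂ → ℂ} {σ L M : ℝ}

/-- The Volterra operator with kernel `K` scales the weighted bounds with exponents `σ`, `L`
by the factor `c`. -/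
def VolterraBoundedBy (Ω : Set ℂ) (K : ℂ → ℂ → ℂ) (σ L c : ℝ) : Prop :=
  ∀ φ M, 0 ≤ M → WeightedBound Ω σ L M φ → WeightedBound Ω σ L (c * M) (volterra K φ)

theorem norm_volterra_le (hΩstar : IsStarAroundZero Ω) (hM : 0 ≤ M)
    (hφ : WeightedBound Ω σ L M φ) {a : ℂ} (ha : a ∈ Ω) {m : ℝ → ℝ}
    (hm : IntervalIntegrable (fun t => t ^ σ * m t) volume 0 1)
    (hKm : ∀ t : ℝ, 0 < t → t ≤ 1 →
      ‖K a ((t : ℂ) * a)‖ * ‖a‖ * Real.exp (-(L * ((1 - t) * ‖a‖))) ≤ m t) :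
    ‖volterra K φ a‖ ≤
      M * (‖a‖ ^ σ * Real.exp (L * ‖a‖)) * ∫ t in (0 : ℝ)..1, t ^ σ * m t := by
  rw [← intervalIntegral.integral_const_mul]
  refine intervalIntegral.norm_integral_le_of_norm_le zero_le_one ?_ (hm.const_mul _)
  filter_upwards with t ht
  refine (norm_volterraIntegrand_le hΩstar hφ ha ht.1 ht.2).trans ?_
  have := ht.1
  gcongr
  exact hKm t ht.1 ht.2

/-- Apply `y ≤ e^y` at `y = νx/γ` and raise to the power `γ`. The constant tends to `0` as `ν → ∞`.
-/
theorem rpow_le_mul_exp {γ ν x : ℝ} (hγ : 0 < γ) (hν : 0 < ν) (hx : 0 ≤ x) :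
    x ^ γ ≤ (γ / ν) ^ γ * Real.exp (ν * x) := by
  have h : x ≤ γ / ν * Real.exp (ν * x / γ) := by
    have h1 : ν * x / γ ≤ Real.exp (ν * x / γ) :=
      (by linarith [Real.add_one_le_exp (ν * x / γ)])
    calc x = γ / ν * (ν * x / γ) := by field_simp
      _ ≤ _ := by gcongr
  calc x ^ γ ≤ (γ / ν * Real.exp (ν * x / γ)) ^ γ := by gcongr
    _ = (γ / ν) ^ γ * Real.exp (ν * x) := by
      rw [Real.mul_rpow (by positivity) (by positivity), ← Real.exp_mul]
      congr 2
      field_simp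

/-- Dominated convergence with majorant `t^σ`: the exponential tends to `0` except at `t = 1`. -/
theorem tendsto_integral_rpow_mul_exp {ε : ℝ} (hσ : -1 < σ) (hε : 0 < ε) :
    Tendsto (fun ν : ℝ => ∫ t in (0 : ℝ)..1, t ^ σ * Real.exp (-(ν * ((1 - t) * ε))))
      atTop (𝓝 0) := by
  have h : Tendsto (fun ν : ℝ => ∫ t in (0 : ℝ)..1, t ^ σ * Real.exp (-(ν * ((1 - t) * ε))))
      atTop (𝓝 (∫ _t in (0 : ℝ)..1, (0 : ℝ))) := by
    refine intervalIntegral.tendsto_integral_filter_of_dominated_convergence (fun t => t ^ σ)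
      ?_ ?_ (intervalIntegral.intervalIntegrable_rpow' hσ) ?_
    · filter_upwards with ν
      exact (by fun_prop : Measurable _).aestronglyMeasurable
    · filter_upwards [eventually_ge_atTop 0] with ν hν
      filter_upwards with t ht
      rw [uIoc_of_le zero_le_one] at ht
      have h0 := ht.1
      have h1 : 0 ≤ 1 - t := by linarith [ht.2]
      rw [Real.norm_of_nonneg (by positivity)]
      exact mul_le_of_le_one_right (by positivity) (Real.exp_le_one_iff.2 (by
        have : 0 ≤ ν * ((1 - t) * ε) := by positivity
        linarith))
    · have h1 : ∀ᵐ t : ℝ, t ≠ 1 := by simp [ae_iff]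
      filter_upwards [h1] with t ht1 ht
      rw [uIoc_of_le zero_le_one] at ht
      have h2 : 0 < (1 - t) * ε := mul_pos (by linarith [lt_of_le_of_ne ht.2 ht1]) hε
      rw [← mul_zero (t ^ σ)]
      refine Tendsto.const_mul _ (Real.tendsto_exp_neg_atTop_nhds_zero.comp ?_)
      exact tendsto_id.atTop_mul_const h2
  simpa using h

theorem WeightedBound.mono {L' M' : ℝ} (hM : 0 ≤ M) (hLL : L ≤ L') (hMM : M ≤ M')
    (h : WeightedBound Ω σ L M φ) : WeightedBound Ω σ L' M' φ := by
  intro a ha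
  refine (h a ha).trans ?_
  have := hM.trans hMM
  gcongr

theorem exists_weightedBound_of_mem (hφ : φ ∈ singExpAlg σ Ω) :
    DifferentiableOn ℂ φ Ω ∧
      ∃ L₀ M, 0 ≤ M ∧ ∀ L, L₀ ≤ L → WeightedBound Ω σ L M φ := by
  obtain ⟨L, hd, M, hM⟩ := mem_iUnion.1 hφ
  refine ⟨hd, L, |M|, abs_nonneg _, fun L' hL => ?_⟩
  have h : WeightedBound Ω σ L |M| φ := fun a ha =>
    (hM a ha).trans (mul_le_mul_of_nonneg_right (le_abs_self M) (by positivity))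
  exact h.mono (abs_nonneg _) hL le_rfl

theorem mem_singExpAlg (hd : DifferentiableOn ℂ φ Ω) (h : WeightedBound Ω σ L M φ) :
    φ ∈ singExpAlg σ Ω :=
  mem_iUnion.2 ⟨L, hd, M, h⟩

theorem volterra_sub {ψ : ℂ → ℂ} {a : ℂ} (hφ : VolterraConverges K φ a)
    (hψ : VolterraConverges K ψ a) :
    volterra K (fun z => φ z - ψ z) a = volterra K φ a - volterra K ψ a := by
  rw [volterra, volterra, volterra, ← intervalIntegral.integral_sub hφ hψ]
  congr 1
  funext t
  simp only [volterraIntegrand]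
  ring

theorem volterra_add_kernel {K' : ℂ → ℂ → ℂ} {a : ℂ} (h : VolterraConverges K φ a)
    (h' : VolterraConverges K' φ a) :
    volterra (fun x y => K x y + K' x y) φ a = volterra K φ a + volterra K' φ a := by
  rw [volterra, volterra, volterra, ← intervalIntegral.integral_add h h']
  congr 1
  funext t
  simp only [volterraIntegrand]
  ring

/-- Each application of `d = K d` improves the bound on `d` by the factor `c`. -/
theorem eq_zero_of_le_const_mul {d : ℂ → ℂ} {c : ℝ} (hc0 : 0 ≤ c) (hc1 : c < 1) (hM : 0 ≤ M)
    (hK : VolterraBoundedBy Ω K σ L c) (hd : WeightedBound Ω σ L M d)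
    (heq : ∀ a ∈ Ω, d a = volterra K d a) : ∀ a ∈ Ω, d a = 0 := by
  have h : ∀ n : ℕ, WeightedBound Ω σ L (c ^ n * M) d := by
    intro n
    induction n with
    | zero => simpa using hd
    | succ n ih =>
      intro a ha
      rw [heq a ha, pow_succ', mul_assoc c]
      exact hK d _ (by positivity) ih a ha
  intro a ha
  have ht : Tendsto (fun n : ℕ => c ^ n * M * (‖a‖ ^ σ * Real.exp (L * ‖a‖))) atTop (𝓝 0) := by
    simpa using ((tendsto_pow_atTop_nhds_zero_of_lt_one hc0 hc1).mul_const M).mul_const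
      (‖a‖ ^ σ * Real.exp (L * ‖a‖))
  exact norm_le_zero_iff.1 (ge_of_tendsto' ht fun n => h n a ha)

/-- The Neumann series solves the inhomogeneous equation. -/
theorem exists_solution (hΩo : IsOpen Ω) (hΩ0 : (0 : ℂ) ∉ Ω) (hΩstar : IsStarAroundZero Ω)
    (hK : IsHolKernel Ω K) (hKb : RadiallyBounded Ω K) (hσ : -1 < σ) {c : ℝ} (hc0 : 0 ≤ c)
    (hc1 : c < 1) (hKc : VolterraBoundedBy Ω K σ L c) {g : ℂ → ℂ}
    (hg : DifferentiableOn ℂ g Ω) (hM : 0 ≤ M) (hgb : WeightedBound Ω σ L M g) :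
    ∃ f ∈ singExpAlg σ Ω, ∀ a ∈ Ω, f a = volterra K f a + g a := by
  set h : ℕ → ℂ → ℂ := fun n => (volterra K)^[n] g with hh
  have hsucc : ∀ n, h (n + 1) = volterra K (h n) := fun n =>
    Function.iterate_succ_apply' _ _ _
  have hprop : ∀ n, DifferentiableOn ℂ (h n) Ω ∧ WeightedBound Ω σ L (c ^ n * M) (h n) := by
    intro n
    induction n with
    | zero => simpa [hh] using ⟨hg, hgb⟩
    | succ n ih =>
      rw [hsucc, pow_succ', mul_assoc]
      exact ⟨differentiableOn_volterra hΩo hΩ0 hΩstar hK hKb hσ ih.1 (by positivity) ih.2,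
        hKc _ _ (by positivity) ih.2⟩
  have hgeo : Summable fun n : ℕ => c ^ n * M :=
    (summable_geometric_of_lt_one hc0 hc1).mul_right M
  have hsum : ∀ a ∈ Ω, Summable fun n => h n a := fun a ha =>
    (hgeo.mul_right _).of_norm_bounded fun n => (hprop n).2 a ha
  set f : ℂ → ℂ := fun a => ∑' n, h n a with hf
  have hfd : DifferentiableOn ℂ f Ω := by
    intro a ha
    -- The weight is locally bounded, so the series converges locally uniformly by the Weierstrass
    -- test.
    set w : ℂ → ℝ := fun z => ‖z‖ ^ σ * Real.exp (L * ‖z‖) with hw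
    have hwc : ContinuousAt w a :=
      (continuous_norm.continuousAt.rpow_const (Or.inl (norm_pos_of_mem hΩ0 ha).ne')).mul
        (by fun_prop)
    obtain ⟨R, hR, hRs⟩ := Metric.mem_nhds_iff.1
      (inter_mem (hwc.eventually_lt_const (lt_add_one (w a))) (hΩo.mem_nhds ha))
    have := Complex.differentiableOn_tsum_of_summable_norm (hgeo.mul_right (w a + 1))
      (fun n => (hprop n).1.mono fun z hz => (hRs hz).2) Metric.isOpen_ball
      (fun n z hz => ((hprop n).2 z (hRs hz).2).trans
        (mul_le_mul_of_nonneg_left (le_of_lt (hRs hz).1) (by positivity)))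
    exact (this.differentiableAt (Metric.ball_mem_nhds a hR)).differentiableWithinAt
  have hfb : WeightedBound Ω σ L (∑' n : ℕ, c ^ n * M) f := fun a ha =>
    tsum_of_norm_bounded (hgeo.hasSum.mul_right _) fun n => (hprop n).2 a ha
  refine ⟨f, mem_singExpAlg hfd hfb, fun a ha => ?_⟩
  obtain ⟨E, -, hE⟩ := hKb.exists_integrand_bound hΩ0 hΩstar σ L
  have hV : HasSum (fun n => volterra K (h n) a) (volterra K f a) := by
    refine intervalIntegral.hasSum_integral_of_dominated_convergence
      (fun n t => c ^ n * M * (E ‖a‖ * t ^ σ)) (fun n => ?_) (fun n => ?_) ?_ ?_ ?_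
    · rw [uIoc_of_le zero_le_one]
      exact aestronglyMeasurable_volterraIntegrand hΩstar hK (hprop n).1 ha
    · filter_upwards with t ht
      rw [uIoc_of_le zero_le_one] at ht
      exact hE _ _ (by positivity) (hprop n).2 a ha t ht.1 ht.2
    · filter_upwards with t _ using hgeo.mul_right _
    · simp only [tsum_mul_right]
      exact ((intervalIntegral.intervalIntegrable_rpow' hσ).const_mul _).const_mul _
    · filter_upwards with t ht
      rw [uIoc_of_le zero_le_one] at ht
      exact ((hsum _ (hΩstar a ha t ht.1 ht.2)).hasSum.mul_left _).mul_right _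
  rw [← hV.tsum_eq, hf]
  simp only [← hsucc]
  rw [(hsum a ha).tsum_eq_zero_add, add_comm]
  rfl

end HolVolterra

/-! ### From the kernel conditions to the contraction -/

namespace HolVolterra

variable {Ω : Set ℂ} {k kstar : ℂ → ℂ → ℂ} {τ γ lam : ℝ}

theorem norm_sub_segment (a : ℂ) {t : ℝ} (ht1 : t ≤ 1) :
    ‖a - (t : ℂ) * a‖ = (1 - t) * ‖a‖ := by
  have h : a - (t : ℂ) * a = ((1 - t : ℝ) : ℂ) * a := by push_cast; ring
  rw [h, norm_mul, Complex.norm_real, Real.norm_of_nonneg (by linarith)]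

theorem CondDiag.exists_segment_bound (hΩ0 : (0 : ℂ) ∉ Ω) (hΩstar : IsStarAroundZero Ω)
    (h : CondDiag Ω k lam) :
    ∃ C, 0 ≤ C ∧ ∀ a ∈ Ω, ∀ t : ℝ, 0 < t → t ≤ 1 →
      ‖k a ((t : ℂ) * a)‖ * ‖a‖ ≤ C * Real.exp (lam * ((1 - t) * ‖a‖)) := by
  obtain ⟨C, hC⟩ := h
  refine ⟨|C|, abs_nonneg _, fun a ha t ht0 ht1 => ?_⟩
  have hr := norm_pos_of_mem hΩ0 ha
  have h1 := hC a ha _ (hΩstar a ha t ht0 ht1)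
  rw [norm_sub_segment a ht1] at h1
  calc _ ≤ C * (1 / ‖a‖ * Real.exp (lam * ((1 - t) * ‖a‖))) * ‖a‖ := by gcongr
    _ = C * Real.exp (lam * ((1 - t) * ‖a‖)) := by field_simp
    _ ≤ _ := by gcongr; exact le_abs_self C

theorem CondDiagStar.exists_segment_bound (hΩ0 : (0 : ℂ) ∉ Ω) (hΩstar : IsStarAroundZero Ω)
    (h : CondDiagStar Ω k γ lam) :
    ∃ C, 0 ≤ C ∧ ∀ a ∈ Ω, ∀ t : ℝ, 0 < t → t ≤ 1 →
      ‖k a ((t : ℂ) * a)‖ * ‖a‖ ≤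
        C * (((1 - t) * ‖a‖) ^ γ * Real.exp (lam * ((1 - t) * ‖a‖))) := by
  obtain ⟨-, C, hC⟩ := h
  refine ⟨|C|, abs_nonneg _, fun a ha t ht0 ht1 => ?_⟩
  have hr := norm_pos_of_mem hΩ0 ha
  have h0 : 0 ≤ (1 - t) * ‖a‖ := mul_nonneg (by linarith) hr.le
  have h1 := hC a ha _ (hΩstar a ha t ht0 ht1)
  rw [norm_sub_segment a ht1] at h1
  calc _ ≤ C * (((1 - t) * ‖a‖) ^ γ / ‖a‖ * Real.exp (lam * ((1 - t) * ‖a‖))) * ‖a‖ := by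
        gcongr
    _ = C * (((1 - t) * ‖a‖) ^ γ * Real.exp (lam * ((1 - t) * ‖a‖))) := by field_simp
    _ ≤ _ := by gcongr; exact le_abs_self C

theorem exp_segment_le {r t : ℝ} (hr : 0 < r) (ht0 : 0 < t) (ht1 : t ≤ 1) :
    Real.exp (lam * ((1 - t) * r)) ≤ Real.exp (|lam| * r) := by
  apply Real.exp_le_exp.2
  have h2 : (1 - t) * r ≤ r := by nlinarith
  have h3 : 0 ≤ (1 - t) * r := mul_nonneg (by linarith) hr.le
  calc lam * ((1 - t) * r) ≤ |lam| * ((1 - t) * r) := by gcongr; exact le_abs_self lam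
    _ ≤ _ := by gcongr

theorem CondDiag.radiallyBounded (hΩ0 : (0 : ℂ) ∉ Ω) (hΩstar : IsStarAroundZero Ω)
    (h : CondDiag Ω k lam) : RadiallyBounded Ω k := by
  obtain ⟨C, hC0, hC⟩ := h.exists_segment_bound hΩ0 hΩstar
  refine ⟨fun r => C * Real.exp (|lam| * r) / r,
    ContinuousOn.div (by fun_prop) continuousOn_id fun r hr => ne_of_gt hr,
    fun a ha t ht0 ht1 => ?_⟩
  have hr := norm_pos_of_mem hΩ0 ha
  rw [le_div_iff₀ hr]
  exact (hC a ha t ht0 ht1).trans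
    (mul_le_mul_of_nonneg_left (exp_segment_le hr ht0 ht1) hC0)

theorem CondDiagStar.radiallyBounded (hΩ0 : (0 : ℂ) ∉ Ω) (hΩstar : IsStarAroundZero Ω)
    (h : CondDiagStar Ω k γ lam) : RadiallyBounded Ω k := by
  have hγ := h.1
  obtain ⟨C, hC0, hC⟩ := h.exists_segment_bound hΩ0 hΩstar
  refine ⟨fun r => C * (r ^ γ * Real.exp (|lam| * r)) / r,
    ContinuousOn.div ?_ continuousOn_id fun r hr => ne_of_gt hr,
    fun a ha t ht0 ht1 => ?_⟩
  · exact (((Real.continuous_rpow_const hγ.le).mul (by fun_prop)).const_mul C).continuousOn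
  have hr := norm_pos_of_mem hΩ0 ha
  rw [le_div_iff₀ hr]
  have h2 : (1 - t) * ‖a‖ ≤ ‖a‖ := by nlinarith
  have h3 : 0 ≤ (1 - t) * ‖a‖ := mul_nonneg (by linarith) hr.le
  refine (hC a ha t ht0 ht1).trans (mul_le_mul_of_nonneg_left ?_ hC0)
  exact mul_le_mul (Real.rpow_le_rpow h3 h2 hγ.le) (exp_segment_le hr ht0 ht1)
    (by positivity) (by positivity)

theorem RadiallyBounded.add {K K' : ℂ → ℂ → ℂ} (h : RadiallyBounded Ω K)
    (h' : RadiallyBounded Ω K') : RadiallyBounded Ω (fun x y => K x y + K' x y) := by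
  obtain ⟨D, hD, hKD⟩ := h
  obtain ⟨D', hD', hKD'⟩ := h'
  exact ⟨fun r => D r + D' r, hD.add hD', fun a ha t ht0 ht1 =>
    (norm_add_le _ _).trans (add_le_add (hKD a ha t ht0 ht1) (hKD' a ha t ht0 ht1))⟩

theorem IsHolKernel.add {K K' : ℂ → ℂ → ℂ} (h : IsHolKernel Ω K) (h' : IsHolKernel Ω K') :
    IsHolKernel Ω (fun x y => K x y + K' x y) :=
  DifferentiableOn.add h h'

theorem isHolKernel_sepKernel {p q : ℂ → ℂ} (hp : DifferentiableOn ℂ p Ω)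
    (hq : DifferentiableOn ℂ q Ω) (hp0 : ∀ a ∈ Ω, p a ≠ 0) : IsHolKernel Ω (sepKernel p q) := by
  have h1 : DifferentiableOn ℂ (fun z : ℂ × ℂ => (p z.1)⁻¹) (Ω ×ˢ Ω) :=
    (hp.fun_inv hp0).comp differentiableOn_fst fun z hz => hz.1
  have h2 : DifferentiableOn ℂ (fun z : ℂ × ℂ => q z.2) (Ω ×ˢ Ω) :=
    hq.comp differentiableOn_snd fun z hz => hz.2
  simpa only [IsHolKernel, sepKernel, div_eq_mul_inv] using (h2.fun_mul h1).fun_neg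

theorem CondSing.exists_segment_bound (hΩ0 : (0 : ℂ) ∉ Ω) (hΩstar : IsStarAroundZero Ω)
    (h : CondSing Ω k τ) {s : ℝ} (hs : τ < s) :
    ∃ ε, 0 < ε ∧ ∀ a ∈ Ω, ‖a‖ < ε → ∀ t : ℝ, 0 < t → t ≤ 1 →
      ‖k a ((t : ℂ) * a)‖ * ‖a‖ ≤ s := by
  obtain ⟨ε, hε, hεs⟩ := Metric.mem_nhdsWithin_iff.1 (h.2.2 s hs)
  refine ⟨ε, hε, fun a ha haε t ht0 ht1 => ?_⟩
  have hr := norm_pos_of_mem hΩ0 ha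
  have hn : ‖(t : ℂ) * a‖ = t * ‖a‖ := by simp [abs_of_pos ht0]
  have hmem : (a, (t : ℂ) * a) ∈ Metric.ball ((0 : ℂ), (0 : ℂ)) ε ∩ Ω ×ˢ Ω := by
    refine ⟨?_, ha, hΩstar a ha t ht0 ht1⟩
    rw [Metric.mem_ball, Prod.dist_eq, max_lt_iff, dist_zero_right, dist_zero_right, hn]
    exact ⟨haε, by nlinarith⟩
  have h1 : ‖k a ((t : ℂ) * a)‖ < s / ‖a‖ := hεs hmem
  exact ((lt_div_iff₀ hr).1 h1).le

/-- For all large exponents `L` the Volterra operator is a contraction in the weighted norm,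
with a factor independent of `L`. -/
theorem eventually_volterraBoundedBy (hΩ0 : (0 : ℂ) ∉ Ω) (hΩstar : IsStarAroundZero Ω)
    (hsing : CondSing Ω k τ) (hdiag : CondDiag Ω k lam) (hstar : CondDiagStar Ω kstar γ lam)
    {ρ : ℝ} (hρ : τ < ρ) :
    ∃ c, 0 ≤ c ∧ c < 1 ∧
      ∀ᶠ L in atTop, VolterraBoundedBy Ω (fun x y => k x y + kstar x y) (ρ - 1) L c := by
  have hτ := hsing.1
  have hγ := hstar.1
  have hρ0 : 0 < ρ := hτ.trans hρ
  have hσ : -1 < ρ - 1 := by linarith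
  -- `s` is the budget for `k`, `u - s` the budget for `kstar`.
  obtain ⟨s, hτs, hsρ⟩ := exists_between hρ
  obtain ⟨u, hsu, huρ⟩ := exists_between hsρ
  have hs0 : 0 < s := hτ.trans hτs
  obtain ⟨ε, hε, hnear⟩ := hsing.exists_segment_bound hΩ0 hΩstar hτs
  obtain ⟨C, hC0, hC⟩ := hdiag.exists_segment_bound hΩ0 hΩstar
  obtain ⟨C', hC'0, hC'⟩ := hstar.exists_segment_bound hΩ0 hΩstar
  refine ⟨u / ρ, div_nonneg (by linarith) hρ0.le, (div_lt_one hρ0).2 huρ, ?_⟩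
  have hshift : Tendsto (fun L : ℝ => L - lam) atTop atTop :=
    tendsto_atTop_add_const_right _ _ tendsto_id
  have hfar : ∀ᶠ L in atTop, C * ∫ t in (0 : ℝ)..1,
      t ^ (ρ - 1) * Real.exp (-((L - lam) * ((1 - t) * ε))) < s / ρ := by
    have h := ((tendsto_integral_rpow_mul_exp hσ hε).comp hshift).const_mul C
    rw [mul_zero] at h
    exact h.eventually_lt_const (by positivity)
  have hreg : ∀ᶠ L in atTop, C' * (γ / (L - lam)) ^ γ < u - s := by
    have h1 : Tendsto (fun L : ℝ => γ / (L - lam)) atTop (𝓝 0) := hshift.const_div_atTop γ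
    have h2 := (h1.rpow_const (p := γ) (Or.inr hγ.le)).const_mul C'
    rw [Real.zero_rpow hγ.ne', mul_zero] at h2
    exact h2.eventually_lt_const (by linarith)
  filter_upwards [hfar, hreg, eventually_ge_atTop 0, eventually_gt_atTop lam]
    with L hfar hreg hL0 hL φ M hM hφ a ha
  have hr := norm_pos_of_mem hΩ0 ha
  have hν : 0 < L - lam := by linarith
  have hI : ∫ t in (0 : ℝ)..1, t ^ (ρ - 1) = 1 / ρ := by
    rw [integral_rpow (Or.inl hσ), sub_add_cancel, Real.one_rpow, Real.zero_rpow hρ0.ne', sub_zero]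
  have hii : IntervalIntegrable (fun t : ℝ => t ^ (ρ - 1)) volume 0 1 :=
    intervalIntegral.intervalIntegrable_rpow' hσ
  have hexp : ∀ t : ℝ, Real.exp (lam * ((1 - t) * ‖a‖)) * Real.exp (-(L * ((1 - t) * ‖a‖))) =
      Real.exp (-((L - lam) * ((1 - t) * ‖a‖))) := fun t => by
    rw [← Real.exp_add]; ring_nf
  have hstarb : ∀ t : ℝ, 0 < t → t ≤ 1 →
      ‖kstar a ((t : ℂ) * a)‖ * ‖a‖ * Real.exp (-(L * ((1 - t) * ‖a‖))) ≤ u - s := by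
    intro t ht0 ht1
    have h0 : 0 ≤ (1 - t) * ‖a‖ := mul_nonneg (by linarith) hr.le
    calc _ ≤ C' * (((1 - t) * ‖a‖) ^ γ * Real.exp (lam * ((1 - t) * ‖a‖))) *
          Real.exp (-(L * ((1 - t) * ‖a‖))) :=
          mul_le_mul_of_nonneg_right (hC' a ha t ht0 ht1) (Real.exp_nonneg _)
      _ = C' * (((1 - t) * ‖a‖) ^ γ * Real.exp (-((L - lam) * ((1 - t) * ‖a‖)))) := by
          rw [← hexp]; ring
      _ ≤ C' * ((γ / (L - lam)) ^ γ * Real.exp ((L - lam) * ((1 - t) * ‖a‖)) *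
          Real.exp (-((L - lam) * ((1 - t) * ‖a‖)))) := by
          gcongr; exact rpow_le_mul_exp hγ hν h0
      _ = C' * (γ / (L - lam)) ^ γ := by
          rw [mul_assoc ((γ / (L - lam)) ^ γ), ← Real.exp_add, add_neg_cancel, Real.exp_zero,
            mul_one]
      _ ≤ u - s := hreg.le
  have hsplit : ∀ t : ℝ, 0 < t → t ≤ 1 → ∀ m : ℝ,
      ‖k a ((t : ℂ) * a)‖ * ‖a‖ * Real.exp (-(L * ((1 - t) * ‖a‖))) ≤ m →
      ‖k a ((t : ℂ) * a) + kstar a ((t : ℂ) * a)‖ * ‖a‖ *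
        Real.exp (-(L * ((1 - t) * ‖a‖))) ≤ m + (u - s) := by
    intro t ht0 ht1 m hm
    calc _ ≤ (‖k a ((t : ℂ) * a)‖ + ‖kstar a ((t : ℂ) * a)‖) * ‖a‖ *
          Real.exp (-(L * ((1 - t) * ‖a‖))) := by gcongr; exact norm_add_le _ _
      _ = _ := by rw [add_mul, add_mul]
      _ ≤ _ := add_le_add hm (hstarb t ht0 ht1)
  have hw : 0 ≤ M * (‖a‖ ^ (ρ - 1) * Real.exp (L * ‖a‖)) := by positivity
  rw [mul_assoc, mul_comm (u / ρ)]
  rcases lt_or_ge ‖a‖ ε with haε | haε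
  -- Near `0` large `L` does not help, as `(1-t)|a|` may be tiny; (sing) supplies the constant `s`.
  · refine (norm_volterra_le hΩstar hM hφ ha (m := fun _ => s + (u - s)) (hii.mul_const _)
      fun t ht0 ht1 => hsplit t ht0 ht1 _ ?_).trans (mul_le_mul_of_nonneg_left (le_of_eq ?_) hw)
    · have h0 : 0 ≤ L * ((1 - t) * ‖a‖) := mul_nonneg hL0 (mul_nonneg (by linarith) hr.le)
      exact (mul_le_of_le_one_right (by positivity) (Real.exp_le_one_iff.2 (by linarith))).trans
        (hnear a ha haε t ht0 ht1)
    · rw [intervalIntegral.integral_mul_const, hI]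
      ring
  · have hie : IntervalIntegrable (fun t : ℝ => t ^ (ρ - 1) *
        Real.exp (-((L - lam) * ((1 - t) * ε)))) volume 0 1 :=
      hii.mul_continuousOn (by fun_prop)
    have hm : (fun t : ℝ => t ^ (ρ - 1) *
        (C * Real.exp (-((L - lam) * ((1 - t) * ε))) + (u - s))) = fun t : ℝ =>
        C * (t ^ (ρ - 1) * Real.exp (-((L - lam) * ((1 - t) * ε)))) + t ^ (ρ - 1) * (u - s) := by
      funext t; ring
    refine (norm_volterra_le hΩstar hM hφ ha
      (m := fun t => C * Real.exp (-((L - lam) * ((1 - t) * ε))) + (u - s)) ?_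
      fun t ht0 ht1 => hsplit t ht0 ht1 _ ?_).trans (mul_le_mul_of_nonneg_left ?_ hw)
    · rw [hm]
      exact (hie.const_mul C).add (hii.mul_const _)
    · have h1 : 0 ≤ 1 - t := by linarith
      calc _ ≤ C * Real.exp (lam * ((1 - t) * ‖a‖)) * Real.exp (-(L * ((1 - t) * ‖a‖))) :=
            mul_le_mul_of_nonneg_right (hC a ha t ht0 ht1) (Real.exp_nonneg _)
        _ = C * Real.exp (-((L - lam) * ((1 - t) * ‖a‖))) := by rw [mul_assoc, hexp]
        -- Replacing `|a|` by `ε` makes the bound uniform over `|a| ≥ ε`.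
        _ ≤ _ := by gcongr
    · rw [hm, intervalIntegral.integral_add (hie.const_mul C) (hii.mul_const _),
        intervalIntegral.integral_const_mul, intervalIntegral.integral_mul_const, hI]
      calc _ ≤ s / ρ + 1 / ρ * (u - s) := by gcongr
        _ = u / ρ := by ring

end HolVolterra

/-! ### The inhomogeneous equation -/

theorem lemma5 (Ω : Set ℂ) (hΩo : IsOpen Ω) (hΩs : IsSimplyConnected Ω)
    (hΩ0 : (0 : ℂ) ∉ Ω) (hΩt : (0 : ℂ) ∈ closure Ω)
    (hΩstar : HolVolterra.IsStarAroundZero Ω)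
    (p q : ℂ → ℂ) (hp : DifferentiableOn ℂ p Ω) (hq : DifferentiableOn ℂ q Ω)
    (hp0 : ∀ a ∈ Ω, p a ≠ 0)
    (kstar : ℂ → ℂ → ℂ) (hkstar : HolVolterra.IsHolKernel Ω kstar)
    (τ γ lam : ℝ)
    (hsing : HolVolterra.CondSing Ω (HolVolterra.sepKernel p q) τ)
    (hdiag : HolVolterra.CondDiag Ω (HolVolterra.sepKernel p q) lam)
    (hdiagstar : HolVolterra.CondDiagStar Ω kstar γ lam)
    (ρ : ℝ) (hρ : τ < ρ)
    (g : ℂ → ℂ) (hg : g ∈ HolVolterra.singExpAlg (ρ - 1) Ω) :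
    -- the integrals defining the operator converge on the whole space
    (∀ φ ∈ HolVolterra.singExpAlg (ρ - 1) Ω, ∀ a ∈ Ω,
      HolVolterra.VolterraConverges (HolVolterra.sepKernel p q) φ a ∧
      HolVolterra.VolterraConverges kstar φ a) ∧
    -- and the inhomogeneous equation has exactly one solution there, as a function on `Ω`
    ∃ f ∈ HolVolterra.singExpAlg (ρ - 1) Ω,
      (∀ a ∈ Ω, f a = HolVolterra.volterra (HolVolterra.sepKernel p q) f a
        + HolVolterra.volterra kstar f a + g a) ∧
      ∀ f' ∈ HolVolterra.singExpAlg (ρ - 1) Ω,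
        (∀ a ∈ Ω, f' a = HolVolterra.volterra (HolVolterra.sepKernel p q) f' a
          + HolVolterra.volterra kstar f' a + g a) →
        Set.EqOn f' f Ω := by
  have hρ1 : -1 < ρ - 1 := by linarith [hsing.1]
  have hk := HolVolterra.isHolKernel_sepKernel hp hq hp0
  have hkb := hdiag.radiallyBounded hΩ0 hΩstar
  have hkstarb := hdiagstar.radiallyBounded hΩ0 hΩstar
  have hconv : ∀ φ ∈ HolVolterra.singExpAlg (ρ - 1) Ω, ∀ a ∈ Ω,
      HolVolterra.VolterraConverges (HolVolterra.sepKernel p q) φ a ∧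
      HolVolterra.VolterraConverges kstar φ a := by
    intro φ hφ a ha
    obtain ⟨hd, L, M, hM, hb⟩ := HolVolterra.exists_weightedBound_of_mem hφ
    exact ⟨HolVolterra.volterraConverges_of_bound hΩ0 hΩstar hk hkb hρ1 hd hM (hb L le_rfl) ha,
      HolVolterra.volterraConverges_of_bound hΩ0 hΩstar hkstar hkstarb hρ1 hd hM
        (hb L le_rfl) ha⟩
  have hadd : ∀ φ ∈ HolVolterra.singExpAlg (ρ - 1) Ω, ∀ a ∈ Ω,
      HolVolterra.volterra (fun x y => HolVolterra.sepKernel p q x y + kstar x y) φ a =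
        HolVolterra.volterra (HolVolterra.sepKernel p q) φ a + HolVolterra.volterra kstar φ a :=
    fun φ hφ a ha => HolVolterra.volterra_add_kernel (hconv φ hφ a ha).1 (hconv φ hφ a ha).2
  have hK := hk.add hkstar
  have hKb := hkb.add hkstarb
  obtain ⟨c, hc0, hc1, hc⟩ :=
    HolVolterra.eventually_volterraBoundedBy hΩ0 hΩstar hsing hdiag hdiagstar hρ
  obtain ⟨hgd, Lg, Mg, hMg, hgb⟩ := HolVolterra.exists_weightedBound_of_mem hg
  obtain ⟨L, hL, hLg⟩ := (hc.and (eventually_ge_atTop Lg)).exists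
  obtain ⟨f, hf, hfeq⟩ := HolVolterra.exists_solution hΩo hΩ0 hΩstar hK hKb hρ1 hc0 hc1 hL
    hgd hMg (hgb L hLg)
  refine ⟨hconv, f, hf, fun a ha => by rw [hfeq a ha, hadd f hf a ha], fun f' hf' hf'eq => ?_⟩
  obtain ⟨hfd, L₁, M₁, hM₁, hb₁⟩ := HolVolterra.exists_weightedBound_of_mem hf
  obtain ⟨hfd', L₂, M₂, hM₂, hb₂⟩ := HolVolterra.exists_weightedBound_of_mem hf'
  -- The two solutions may have different growth exponents; one `L'` dominates both and still gives
  -- a contraction.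
  obtain ⟨L', hL', hL₁, hL₂⟩ :=
    (hc.and ((eventually_ge_atTop L₁).and (eventually_ge_atTop L₂))).exists
  have hdb : HolVolterra.WeightedBound Ω (ρ - 1) L' (M₂ + M₁) (fun z => f' z - f z) :=
    fun a ha => (norm_sub_le _ _).trans
      ((add_le_add (hb₂ L' hL₂ a ha) (hb₁ L' hL₁ a ha)).trans_eq (add_mul _ _ _).symm)
  have hzero := HolVolterra.eq_zero_of_le_const_mul hc0 hc1 (add_nonneg hM₂ hM₁) hL' hdb
    fun a ha => by
      rw [HolVolterra.volterra_sub
        (HolVolterra.volterraConverges_of_bound hΩ0 hΩstar hK hKb hρ1 hfd' hM₂ (hb₂ L' hL₂) ha)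
        (HolVolterra.volterraConverges_of_bound hΩ0 hΩstar hK hKb hρ1 hfd hM₁ (hb₁ L' hL₁) ha),
        hadd f' hf' a ha]
      nth_rw 1 [hf'eq a ha, hfeq a ha]
      ring
  exact fun a ha => sub_eq_zero.1 (hzero a ha)
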